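/- **Notation.** For a permutation $\pi=\pi_1\cdots\pi_n\in\mathfrak S_n$ (with $\mathfrak S_0$ consisting of the empty word only), let $\operatorname{inv}(\pi)$ be the number of pairs $i<j$ with $\pi_i>\pi_j$, let $\operatorname{des}(\pi)$ be the number of descents, i.e. of $i\in\{1,\dots,n-1\}$ with $\pi_i>\pi_{i+1}$, and let $\operatorname{lpk}(\pi)$ be the number of left peaks, i.e. of $i\in\{1,\dots,n-1\}$ such that either $i\ge 2$ and $\pi_{i-1}<\pi_i>\pi_{i+1}$, or $i=1$ and $\pi_1>\pi_2$. Put $$P_n^{(\operatorname{inv},\operatorname{lpk},\operatorname{des})}(q,y,t)=\sum_{\pi\in\mathfrak S_n}q^{\operatorname{inv}(\pi)}y^{\operatorname{lpk}(\pi)}t^{\operatorname{des}(\pi)},\qquad [n]_q!=\prod_{k=1}^{n}(1+q+\cdots+q^{k-1}),$$ $$\exp_q(x)=\sum_{n\ge0}\frac{x^n}{[n]_q!},\qquad \operatorname{Exp}_q(x)=\sum_{n\ge0}q^{\binom n2}\frac{x^n}{[n]_q!}.$$ **Theorem 4.7.** Let $K$ be a field of characteristic zero and let $q\in K$ be such that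 $[n]_q!\neq0$ for all $n\ge 0$ (for example, $q$ an indeterminate). The following identities hold in the ring $K[[x]]$ of formal power series. (a) For all $y,t\in K$ (for example, indeterminates) with $t\ne1$, $y+t\neq0$ and $1+yt\neq0$, $$\frac{(1-t)\exp_q(x)}{1-t\operatorname{Exp}_q(yx)\exp_q(x)}=\sum_{n=0}^\infty\left(\frac{1+yt}{1-t}\right)^{n}P_n^{(\operatorname{inv},\operatorname{lpk},\operatorname{des})}\left(q,\frac{(1+y)^2t}{(y+t)(1+yt)},\frac{y+t}{1+yt}\right)\frac{x^n}{[n]_q!}.$$ (b) For all $y,t\in K$ (for example, indeterminates) with $y\ne0$, $y\neq1$, $t\neq0$ and $(1+t)^2\neq4yt$, and for either choice of a square root $\sqrt{(1+t)^2-4yt}$ in $K$ (supposed to exist), put $$u=\frac{1+t^2-2yt-(1-t)\sqrt{(1+t)^2-4yt}}{2(1-y)t},\qquad v=\frac{(1+t)^2-2yt-(1+t)\sqrt{(1+t)^2-4yt}}{2yt}.$$ Then $v\ne1$, $1+uv\neq0$, and $$\sum_{n=0}^\infty P_n^{(\operatorname{inv},\operatorname{lpk},\operatorname{des})}(q,y,t)\frac{x^n}{[n]_q!}=\frac{(1-v)\exp_q\left(\frac{1-v}{1+uv}x\right)}{1-v\operatorname{Exp}_q\left(\frac{u(1-v)}{1+uv}x\right)\exp_q\left(\frac{1-v}{1+uv}x\right)}.$$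 -/

import Mathlib

namespace LeftPeak

/-- The `q`-factorial `[n]_q! = ∏_{k=1}^{n} (1 + q + ⋯ + q^{k-1})`. -/
def qFactorial {R : Type*} [CommRing R] (q : R) (n : ℕ) : R :=
  ∏ i ∈ Finset.range n, ∑ j ∈ Finset.range (i + 1), q ^ j

/-- The `q`-exponential `exp_q(x) = ∑ x^n / [n]_q!`, a formal power series in `x`. -/
noncomputable def qexp {K : Type*} [Field K] (q : K) : PowerSeries K :=
  PowerSeries.mk fun n => 1 / qFactorial q n

/-- The variant `Exp_q(x) = ∑ q^{n(n-1)/2} x^n / [n]_q!`. -/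
noncomputable def qExp {K : Type*} [Field K] (q : K) : PowerSeries K :=
  PowerSeries.mk fun n => q ^ n.choose 2 / qFactorial q n

/-- Positions are `0`-based: the letter `π_{i+1}` of the word of `π` is `π i` for `i : Fin n`. -/
def IsDescent {n : ℕ} (π : Equiv.Perm (Fin n)) (i : Fin n) : Prop :=
  ∃ j : Fin n, j.val = i.val + 1 ∧ π j < π i

def IsPeak {n : ℕ} (π : Equiv.Perm (Fin n)) (i : Fin n) : Prop :=
  ∃ h j : Fin n, i.val = h.val + 1 ∧ j.val = i.val + 1 ∧ π h < π i ∧ π j < π i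

def IsLeftPeak {n : ℕ} (π : Equiv.Perm (Fin n)) (i : Fin n) : Prop :=
  IsPeak π i ∨ (i.val = 0 ∧ IsDescent π i)

instance {n : ℕ} (π : Equiv.Perm (Fin n)) : DecidablePred (IsDescent π) := fun _ =>
  inferInstanceAs (Decidable (∃ _, _))

instance {n : ℕ} (π : Equiv.Perm (Fin n)) : DecidablePred (IsPeak π) := fun _ =>
  inferInstanceAs (Decidable (∃ _, _))

instance {n : ℕ} (π : Equiv.Perm (Fin n)) : DecidablePred (IsLeftPeak π) := fun _ =>
  inferInstanceAs (Decidable (_ ∨ _))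

/-- The number of inversions: pairs `i < j` with `π i > π j`. -/
def inv {n : ℕ} (π : Equiv.Perm (Fin n)) : ℕ :=
  (Finset.univ.filter fun p : Fin n × Fin n => p.1 < p.2 ∧ π p.2 < π p.1).card

/-- The number of left peaks. -/
def lpk {n : ℕ} (π : Equiv.Perm (Fin n)) : ℕ :=
  (Finset.univ.filter fun i : Fin n => IsLeftPeak π i).card

/-- The number of descents. -/
def des {n : ℕ} (π : Equiv.Perm (Fin n)) : ℕ :=
  (Finset.univ.filter fun i : Fin n => IsDescent π i).card

/-- The value at `(q, y, t)` of the polynomial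
`P_n^{(inv, lpk, des)} = ∑_{π ∈ S_n} q^{inv π} y^{lpk π} t^{des π}`. -/
def invLpkDesPoly {R : Type*} [CommRing R] (n : ℕ) (q y t : R) : R :=
  ∑ π : Equiv.Perm (Fin n), q ^ inv π * y ^ lpk π * t ^ des π

end LeftPeak

/-! With F the right-hand series in (a), clearing the denominator turns (a) into F = (1-t) exp_q + t
F Exp_q(yx) exp_q. Its coefficients form the convolution recurrence `pow_mul_invLpkDesPoly_eq`;
series enter only afterwards.

A permutation grows by appending a last letter. The change in inversions, left peaks and descents
depends only on the number of earlier letters exceeding the old and the new last letter, and on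
whether the old last step is a descent (`sum_perm_eq_sum_stateWeights`). On the series side,
Exp_q(yx) counts appended blocks of descents and exp_q appended blocks of ascents
(`sum_descStep_iterate`, `sum_ascStep_iterate`). For the specialised arguments the weights of these
block constructions are linear combinations of the true state weights, which forces the recurrence.

Part (b) is (a) at (u, v) with x rescaled: u and v invert the change of variables. -/

namespace LeftPeak

/-! ### Gaussian binomial coefficients. -/

section Gauss

variable {R : Type*} [CommRing R] (q : R)

/-- The Gaussian binomial coefficient, defined by the `q`-Pascal rule. -/
def gaussBinom (q : R) : ℕ → ℕ → R
  | _, 0 => 1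
  | 0, _ + 1 => 0
  | n + 1, k + 1 => gaussBinom q n k + q ^ (k + 1) * gaussBinom q n (k + 1)

@[simp] lemma gaussBinom_zero_right (n : ℕ) : gaussBinom q n 0 = 1 := by
  cases n <;> rfl

@[simp] lemma gaussBinom_zero_succ (k : ℕ) : gaussBinom q 0 (k + 1) = 0 := rfl

lemma gaussBinom_succ_succ (n k : ℕ) :
    gaussBinom q (n + 1) (k + 1) = gaussBinom q n k + q ^ (k + 1) * gaussBinom q n (k + 1) := rfl

/-- The second `q`-Pascal rule. -/
lemma pow_mul_gaussBinom_succ_sub (n k : ℕ) :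
    q ^ k * (gaussBinom q (n + 1) (k + 1) - gaussBinom q n (k + 1)) = q ^ n * gaussBinom q n k := by
  -- The usual rule has q^(n-k) on the right. The extra factor q^k avoids this exponent, so k > n is
  -- allowed and q need not be invertible.
  induction n generalizing k with
  | zero => cases k <;> simp [gaussBinom_succ_succ]
  | succ n ih =>
    cases k with
    | zero =>
      have h := ih 0
      rw [gaussBinom_succ_succ q (n + 1), gaussBinom_succ_succ q n] at *
      simp only [gaussBinom_zero_right, pow_zero, one_mul, mul_one, zero_add, pow_one] at *
      linear_combination q * h
    | succ k =>
      have h1 := ih k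
      have h2 := ih (k + 1)
      have e1 := gaussBinom_succ_succ q (n + 1) (k + 1)
      have e2 := gaussBinom_succ_succ q n (k + 1)
      have e3 := gaussBinom_succ_succ q n k
      linear_combination q ^ (k + 1) * e1 - q ^ (k + 1) * e2 + q * h1 + q ^ (k + 2) * h2
        - q ^ (n + 1) * e3

lemma gaussBinom_eq_zero {n k : ℕ} (h : n < k) : gaussBinom q n k = 0 := by
  induction n generalizing k with
  | zero => obtain ⟨k, rfl⟩ := Nat.exists_eq_succ_of_ne_zero h.ne'; rfl
  | succ n ih =>
    obtain ⟨k, rfl⟩ := Nat.exists_eq_succ_of_ne_zero (Nat.ne_zero_of_lt h)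
    rw [Nat.succ_eq_add_one, gaussBinom_succ_succ, ih (by omega), ih (by omega)]; simp

lemma gaussBinom_self (n : ℕ) : gaussBinom q n n = 1 := by
  induction n with
  | zero => rfl
  | succ n ih => rw [gaussBinom_succ_succ, ih, gaussBinom_eq_zero q (Nat.lt_succ_self n)]; simp

lemma qFactorial_succ (n : ℕ) :
    qFactorial q (n + 1) = qFactorial q n * ∑ j ∈ Finset.range (n + 1), q ^ j :=
  Finset.prod_range_succ _ _

@[simp] lemma qFactorial_zero : qFactorial q 0 = 1 := rfl

lemma gaussBinom_mul_qFactorial (a b : ℕ) :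
    gaussBinom q (a + b) a * (qFactorial q a * qFactorial q b) = qFactorial q (a + b) := by
  induction hn : a + b generalizing a b with
  | zero => obtain ⟨rfl, rfl⟩ : a = 0 ∧ b = 0 := by omega
            simp
  | succ n ih =>
    rcases a with _ | a
    · obtain rfl : b = n + 1 := by omega
      simp
    rcases b with _ | b
    · obtain rfl : a = n := by omega
      simp [gaussBinom_self]
    · have h1 := ih a (b + 1) (by omega)
      have h2 := ih (a + 1) b (by omega)
      obtain rfl : n = a + 1 + b := by omega
      have hs : ∑ j ∈ Finset.range (a + 1 + b + 1), q ^ j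
          = ∑ j ∈ Finset.range (a + 1), q ^ j + q ^ (a + 1) * ∑ j ∈ Finset.range (b + 1), q ^ j := by
        rw [add_assoc (a + 1), Finset.sum_range_add, Finset.mul_sum]
        simp only [pow_add]
      rw [gaussBinom_succ_succ, qFactorial_succ q (a + 1 + b), hs]
      have ea := qFactorial_succ q a
      have eb := qFactorial_succ q b
      rw [ea] at h2 ⊢
      rw [eb] at h1 ⊢
      linear_combination (∑ j ∈ Finset.range (a + 1), q ^ j) * h1
        + q ^ (a + 1) * (∑ j ∈ Finset.range (b + 1), q ^ j) * h2

end Gauss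

/-! ### Blocks of descents and of ascents. -/

section Steps

variable {R : Type*} [CommRing R] (q : R)

/-- Appending a descent: a weight vector `f`, indexed by the number `c` of earlier letters that are
larger than the last letter, is sent to the weight vector of the words with one more letter. -/
def descStep (f : ℕ → R) (c : ℕ) : R := q ^ c * ∑ b ∈ Finset.range c, f b

/-- Appending an ascent to words of length `n`. -/
def ascStep (n : ℕ) (f : ℕ → R) (c : ℕ) : R :=
  q ^ c * (∑ b ∈ Finset.range n, f b - ∑ b ∈ Finset.range c, f b)

/-- Partial sums for iterated descents. -/
lemma sum_descStep_iterate (y : R) (p : ℕ → R) (S : ℕ → ℕ → R) (h0 : ∀ c, S 0 c = 0)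
    (hS : ∀ n c, S (n + 1) c = p n * q ^ c + y * descStep q (S n) c) (n c : ℕ) :
    y * ∑ b ∈ Finset.range c, S n b =
      ∑ i ∈ Finset.range n,
        p i * (y ^ (n - i) * q ^ (n - i).choose 2 * gaussBinom q c (n - i)) := by
  -- Unrolled, the term of p i sums q^(b₁+⋯+b_k) over strict chains c > b₁ > ⋯ > b_k ≥ 0 with k = n
  -- - i, that is, over k-subsets of {0, …, c-1}.
  induction n generalizing c with
  | zero => simp [h0]
  | succ n ih =>
    induction c with
    | zero =>
      rw [Finset.sum_range_zero, mul_zero, eq_comm]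
      refine Finset.sum_eq_zero fun i hi => ?_
      rw [Nat.succ_sub (Finset.mem_range_succ_iff.1 hi), gaussBinom_zero_succ]; simp
    | succ c ihc =>
      rw [Finset.sum_range_succ, mul_add, ihc, hS, descStep, ← eq_sub_iff_add_eq',
        ← Finset.sum_sub_distrib]
      have key : ∀ i ∈ Finset.range (n + 1),
          p i * (y ^ (n + 1 - i) * q ^ (n + 1 - i).choose 2 * gaussBinom q (c + 1) (n + 1 - i)) -
          p i * (y ^ (n + 1 - i) * q ^ (n + 1 - i).choose 2 * gaussBinom q c (n + 1 - i)) =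
          y * q ^ c * (p i * (y ^ (n - i) * q ^ (n - i).choose 2 * gaussBinom q c (n - i))) := by
        intro i hi
        rw [Nat.succ_sub (Finset.mem_range_succ_iff.1 hi)]
        generalize n - i = k
        have h := pow_mul_gaussBinom_succ_sub q c k
        rw [Nat.succ_eq_add_one, Nat.choose_succ_succ' k 1, Nat.choose_one_right, pow_add, pow_succ]
        linear_combination p i * y ^ k * y * q ^ k.choose 2 * h
      rw [Finset.sum_congr rfl key, ← Finset.mul_sum, Finset.sum_range_succ, ← ih]
      simp
      ring

/-- Tail sums for iterated ascents. -/
lemma sum_sub_sum_ascStep_iterate (z : ℕ → R) (N : ℕ → ℕ → R) (h0 : ∀ c, N 0 c = 0)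
    (hN : ∀ n c, N (n + 1) c = z n * q ^ c + ascStep q n (N n) c) (n m c : ℕ) (h : m + c = n) :
    ∑ b ∈ Finset.range n, N n b - ∑ b ∈ Finset.range c, N n b =
      ∑ i ∈ Finset.range n, z i * (q ^ ((n - i) * c) * gaussBinom q m (n - i)) := by
  -- Unrolled, the term of z i runs over weakly monotone chains of n - i values between c and i,
  -- that is, partitions in a box, each part shifted by c.
  induction n generalizing m c with
  | zero => simp [h0]
  | succ n ih =>
    induction m generalizing c with
    | zero =>
      obtain rfl : c = n + 1 := by omega
      rw [sub_self, eq_comm]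
      refine Finset.sum_eq_zero fun i hi => ?_
      rw [Nat.succ_sub (Finset.mem_range_succ_iff.1 hi), gaussBinom_zero_succ]; simp
    | succ m ihm =>
      have h1 := ihm (c + 1) (by omega)
      rw [Finset.sum_range_succ (N (n + 1)) c, ← sub_sub, sub_eq_iff_eq_add] at h1
      rw [h1, hN, ascStep, ih m c (by omega), ← eq_sub_iff_add_eq', ← Finset.sum_sub_distrib]
      have key : ∀ i ∈ Finset.range (n + 1),
          z i * (q ^ ((n + 1 - i) * c) * gaussBinom q (m + 1) (n + 1 - i)) -
          z i * (q ^ ((n + 1 - i) * (c + 1)) * gaussBinom q m (n + 1 - i)) =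
          q ^ c * (z i * (q ^ ((n - i) * c) * gaussBinom q m (n - i))) := by
        intro i hi
        rw [Nat.succ_sub (Finset.mem_range_succ_iff.1 hi)]
        generalize n - i = k
        rw [Nat.succ_eq_add_one, gaussBinom_succ_succ]
        ring
      rw [Finset.sum_congr rfl key, ← Finset.mul_sum, Finset.sum_range_succ]
      simp
      ring

lemma sum_ascStep_iterate (z : ℕ → R) (N : ℕ → ℕ → R) (h0 : ∀ c, N 0 c = 0)
    (hN : ∀ n c, N (n + 1) c = z n * q ^ c + ascStep q n (N n) c) (n : ℕ) :
    ∑ b ∈ Finset.range n, N n b = ∑ i ∈ Finset.range n, z i * gaussBinom q n (n - i) := by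
  simpa using sum_sub_sum_ascStep_iterate q z N h0 hN n n 0 rfl

end Steps

/-! ### Appending a last letter. -/

/-- The permutation obtained from `σ` by appending the letter `a`, the letters of `σ` that are at
least `a` being raised by one. -/
def appendLetter {n : ℕ} (a : Fin (n + 1)) (σ : Equiv.Perm (Fin n)) : Equiv.Perm (Fin (n + 1)) :=
  (finSuccEquiv' (Fin.last n)).trans ((Equiv.optionCongr σ).trans (finSuccEquiv' a).symm)

@[simp] lemma appendLetter_last {n : ℕ} (a : Fin (n + 1)) (σ : Equiv.Perm (Fin n)) :
    appendLetter a σ (Fin.last n) = a := by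
  simp [appendLetter]

@[simp] lemma appendLetter_castSucc {n : ℕ} (a : Fin (n + 1)) (σ : Equiv.Perm (Fin n)) (i : Fin n) :
    appendLetter a σ i.castSucc = a.succAbove (σ i) := by
  simp [appendLetter, ← Fin.succAbove_last]

lemma appendLetter_bijective (n : ℕ) :
    Function.Bijective fun p : Fin (n + 1) × Equiv.Perm (Fin n) => appendLetter p.1 p.2 := by
  rw [Fintype.bijective_iff_injective_and_card]
  constructor
  · rintro ⟨a, σ⟩ ⟨b, τ⟩ h
    have h' : ∀ i, appendLetter a σ i = appendLetter b τ i := fun i => DFunLike.congr_fun h i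
    obtain rfl : a = b := by simpa using h' (Fin.last n)
    have : σ = τ := by
      ext i
      have := h' i.castSucc
      simp only [appendLetter_castSucc] at this
      rw [Fin.succAbove_right_injective this]
    rw [this]
  · simp [Fintype.card_perm, Nat.factorial_succ]

lemma sum_perm_succ {M : Type*} [AddCommMonoid M] {n : ℕ} (F : Equiv.Perm (Fin (n + 1)) → M) :
    ∑ π, F π = ∑ σ : Equiv.Perm (Fin n), ∑ a : Fin (n + 1), F (appendLetter a σ) := by
  rw [← (appendLetter_bijective n).sum_comp, Fintype.sum_prod_type, Finset.sum_comm]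

lemma inv_appendLetter {n : ℕ} (a : Fin (n + 1)) (σ : Equiv.Perm (Fin n)) :
    inv (appendLetter a σ) = inv σ + (n - a) := by
  have hcard : ∀ {m : ℕ} (π : Equiv.Perm (Fin m)),
      inv π = ∑ i, ∑ j, if i < j ∧ π j < π i then 1 else 0 := by
    intro m π
    rw [inv, Finset.card_filter, Fintype.sum_prod_type]
  have hlast : ∑ i : Fin n, (if a < a.succAbove (σ i) then 1 else 0) = n - (a : ℕ) := by
    rw [Equiv.sum_comp σ fun i => if a < a.succAbove i then 1 else 0, ← Finset.card_filter]
    simp only [Fin.lt_succAbove_iff_le_castSucc]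
    have : (Finset.univ.filter fun i : Fin n => a ≤ i.castSucc).card
        = ((Finset.range n).filter fun i => (a : ℕ) ≤ i).card := by
      rw [Finset.card_filter, Finset.card_filter,
        ← Fin.sum_univ_eq_sum_range (fun i => if (a : ℕ) ≤ i then 1 else 0)]
      rfl
    rw [this]
    have : ((Finset.range n).filter fun i => (a : ℕ) ≤ i) = Finset.Ico (a : ℕ) n := by
      ext i; simp [and_comm]
    rw [this, Nat.card_Ico]
  rw [hcard, hcard, Fin.sum_univ_castSucc]
  simp only [Fin.sum_univ_castSucc, appendLetter_castSucc, appendLetter_last,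
    Fin.castSucc_lt_castSucc_iff, Fin.castSucc_lt_last, true_and,
    Fin.succAbove_lt_succAbove_iff, lt_irrefl, and_false, Finset.sum_add_distrib, hlast]
  simp [Fin.not_lt.2 (Fin.le_last _)]

/-- The last step is a descent. -/
def EndsInDescent {n : ℕ} (π : Equiv.Perm (Fin n)) : Prop :=
  ∃ i : Fin n, i.val + 2 = n ∧ IsDescent π i

instance {n : ℕ} (π : Equiv.Perm (Fin n)) : Decidable (EndsInDescent π) :=
  inferInstanceAs (Decidable (∃ _, _))

/-- Left peaks are the starts of maximal runs of descents; the convention at position 0 removes the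
boundary exception. Hence an appended letter creates a left peak exactly when it starts a new run.
-/
lemma isLeftPeak_iff {n : ℕ} (π : Equiv.Perm (Fin n)) (i : Fin n) :
    IsLeftPeak π i ↔ IsDescent π i ∧ ¬ ∃ h : Fin n, h.val + 1 = i.val ∧ IsDescent π h := by
  constructor
  · rintro (⟨h, j, hi, hj, h1, h2⟩ | ⟨h0, hd⟩)
    · refine ⟨⟨j, hj, h2⟩, ?_⟩
      rintro ⟨h', hh, k, hk, hlt⟩
      obtain rfl : h' = h := by ext; omega
      obtain rfl : k = i := by ext; omega
      exact lt_asymm h1 hlt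
    · refine ⟨hd, ?_⟩
      rintro ⟨h', hh, -⟩
      omega
  · rintro ⟨⟨j, hj, hlt⟩, hn⟩
    by_cases h0 : i.val = 0
    · exact Or.inr ⟨h0, j, hj, hlt⟩
    · refine Or.inl ⟨⟨i.val - 1, by omega⟩, j, by simp; omega, hj, ?_, hlt⟩
      by_contra hc
      refine hn ⟨⟨i.val - 1, by omega⟩, by simp; omega, i, by simp; omega, ?_⟩
      refine lt_of_le_of_ne (not_lt.1 hc) fun he => ?_
      have := congrArg Fin.val (π.injective he)
      simp at this
      omega

lemma not_isDescent_last {n : ℕ} (π : Equiv.Perm (Fin (n + 1))) : ¬ IsDescent π (Fin.last n) := by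
  rintro ⟨j, hj, -⟩
  simp at hj
  omega

lemma isDescent_appendLetter_castSucc_castSucc {n : ℕ} (a : Fin (n + 2))
    (σ : Equiv.Perm (Fin (n + 1))) (i : Fin n) :
    IsDescent (appendLetter a σ) i.castSucc.castSucc ↔ IsDescent σ i.castSucc := by
  constructor
  · rintro ⟨j, hj, hlt⟩
    obtain rfl : j = i.succ.castSucc := by ext; simpa using hj
    exact ⟨i.succ, by simp, by simpa only [appendLetter_castSucc,
      Fin.succAbove_lt_succAbove_iff] using hlt⟩
  · rintro ⟨j, hj, hlt⟩
    exact ⟨j.castSucc, by simpa using hj, by simpa only [appendLetter_castSucc,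
      Fin.succAbove_lt_succAbove_iff] using hlt⟩

lemma isDescent_appendLetter_castSucc_last {n : ℕ} (a : Fin (n + 2))
    (σ : Equiv.Perm (Fin (n + 1))) :
    IsDescent (appendLetter a σ) (Fin.last n).castSucc ↔ a ≤ (σ (Fin.last n)).castSucc := by
  rw [← Fin.lt_succAbove_iff_le_castSucc]
  constructor
  · rintro ⟨j, hj, hlt⟩
    obtain rfl : j = Fin.last (n + 1) := by ext; simpa using hj
    simpa using hlt
  · intro h
    exact ⟨Fin.last _, by simp, by simpa using h⟩

lemma endsInDescent_appendLetter {n : ℕ} (a : Fin (n + 2)) (σ : Equiv.Perm (Fin (n + 1))) :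
    EndsInDescent (appendLetter a σ) ↔ a ≤ (σ (Fin.last n)).castSucc := by
  rw [← isDescent_appendLetter_castSucc_last]
  constructor
  · rintro ⟨i, hi, h⟩
    obtain rfl : i = (Fin.last n).castSucc := by ext; simp; omega
    exact h
  · intro h
    exact ⟨_, by simp, h⟩

lemma des_appendLetter {n : ℕ} (a : Fin (n + 2)) (σ : Equiv.Perm (Fin (n + 1))) :
    des (appendLetter a σ) = des σ + if a ≤ (σ (Fin.last n)).castSucc then 1 else 0 := by
  rw [des, des, Finset.card_filter, Finset.card_filter, Fin.sum_univ_castSucc,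
    Fin.sum_univ_castSucc, Fin.sum_univ_castSucc]
  simp only [isDescent_appendLetter_castSucc_castSucc, isDescent_appendLetter_castSucc_last,
    not_isDescent_last, if_false, add_zero]

lemma isLeftPeak_appendLetter_castSucc_castSucc {n : ℕ} (a : Fin (n + 2))
    (σ : Equiv.Perm (Fin (n + 1))) (i : Fin n) :
    IsLeftPeak (appendLetter a σ) i.castSucc.castSucc ↔ IsLeftPeak σ i.castSucc := by
  rw [isLeftPeak_iff, isLeftPeak_iff, isDescent_appendLetter_castSucc_castSucc]
  refine and_congr_right fun _ => not_congr ⟨?_, ?_⟩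
  · rintro ⟨h, hi, hd⟩
    obtain ⟨k, rfl⟩ : ∃ k : Fin n, h = k.castSucc.castSucc :=
      ⟨⟨h.val, by simp at hi; omega⟩, by ext; rfl⟩
    exact ⟨k.castSucc, by simpa using hi, (isDescent_appendLetter_castSucc_castSucc a σ k).1 hd⟩
  · rintro ⟨h, hi, hd⟩
    obtain ⟨k, rfl⟩ : ∃ k : Fin n, h = k.castSucc :=
      ⟨⟨h.val, by simp at hi; omega⟩, by ext; rfl⟩
    exact ⟨k.castSucc.castSucc, by simpa using hi,
      (isDescent_appendLetter_castSucc_castSucc a σ k).2 hd⟩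

lemma isLeftPeak_appendLetter_castSucc_last {n : ℕ} (a : Fin (n + 2))
    (σ : Equiv.Perm (Fin (n + 1))) :
    IsLeftPeak (appendLetter a σ) (Fin.last n).castSucc ↔
      a ≤ (σ (Fin.last n)).castSucc ∧ ¬ EndsInDescent σ := by
  rw [isLeftPeak_iff, isDescent_appendLetter_castSucc_last]
  refine and_congr_right fun _ => not_congr ⟨?_, ?_⟩
  · rintro ⟨h, hi, hd⟩
    obtain ⟨k, rfl⟩ : ∃ k : Fin n, h = k.castSucc.castSucc :=
      ⟨⟨h.val, by simp at hi; omega⟩, by ext; rfl⟩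
    exact ⟨k.castSucc, by simpa using hi, (isDescent_appendLetter_castSucc_castSucc a σ k).1 hd⟩
  · rintro ⟨h, hi, hd⟩
    obtain ⟨k, rfl⟩ : ∃ k : Fin n, h = k.castSucc :=
      ⟨⟨h.val, by omega⟩, by ext; rfl⟩
    exact ⟨k.castSucc.castSucc, by simpa using hi,
      (isDescent_appendLetter_castSucc_castSucc a σ k).2 hd⟩

lemma not_isLeftPeak_last {n : ℕ} (π : Equiv.Perm (Fin (n + 1))) : ¬ IsLeftPeak π (Fin.last n) :=
  fun h => not_isDescent_last π ((isLeftPeak_iff π _).1 h).1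

lemma lpk_appendLetter {n : ℕ} (a : Fin (n + 2)) (σ : Equiv.Perm (Fin (n + 1))) :
    lpk (appendLetter a σ) =
      lpk σ + if a ≤ (σ (Fin.last n)).castSucc ∧ ¬ EndsInDescent σ then 1 else 0 := by
  rw [lpk, lpk, Finset.card_filter, Finset.card_filter, Fin.sum_univ_castSucc,
    Fin.sum_univ_castSucc, Fin.sum_univ_castSucc]
  simp only [isLeftPeak_appendLetter_castSucc_castSucc, isLeftPeak_appendLetter_castSucc_last,
    not_isLeftPeak_last, if_false, add_zero]

/-! ### Transfer recursion for the state weights. -/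

section States

variable {R : Type*} [CommRing R] (q Y T : R)

/-- The weights of the permutations of length `n + 1`, by the number of letters larger than the
last one: first those that do not end in a descent, then those that do. -/
def stateWeights : ℕ → (ℕ → R) × (ℕ → R)
  | 0 => (fun c => q ^ c, fun _ => 0)
  | n + 1 =>
    (ascStep q (n + 1) fun c => (stateWeights n).1 c + (stateWeights n).2 c,
      descStep q fun c => Y * T * (stateWeights n).1 c + T * (stateWeights n).2 c)

/-- The test function φ is arbitrary so that the induction closes: summing over the appended letter
yields another test function of the shorter permutation's state. -/
lemma sum_perm_eq_sum_stateWeights (n : ℕ) (φ : ℕ → Prop → R) :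
    ∑ π : Equiv.Perm (Fin (n + 1)), q ^ inv π * Y ^ lpk π * T ^ des π *
        φ (n - π (Fin.last n)) (EndsInDescent π) =
      ∑ c ∈ Finset.range (n + 1),
        ((stateWeights q Y T n).1 c * φ c False + (stateWeights q Y T n).2 c * φ c True) := by
  classical
  induction n generalizing φ with
  | zero =>
    have hd : ∀ π : Equiv.Perm (Fin 1), ∀ i, ¬ IsDescent π i := by
      rintro π i ⟨j, hj, -⟩
      omega
    have he : ∀ π : Equiv.Perm (Fin 1), EndsInDescent π = False := by
      rintro π
      simp only [EndsInDescent, hd, and_false, exists_false]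
    have h1 : ∀ π : Equiv.Perm (Fin 1), inv π = 0 := by
      intro π
      simp [inv, Subsingleton.elim _ (0 : Fin 1)]
    have h2 : ∀ π : Equiv.Perm (Fin 1), lpk π = 0 := by
      intro π
      simp [lpk, isLeftPeak_iff, hd]
    have h3 : ∀ π : Equiv.Perm (Fin 1), des π = 0 := by
      intro π
      simp [des, hd]
    simp [h1, h2, h3, he, stateWeights]
  | succ n ih =>
    set ψ : ℕ → Prop → R := fun c b => ∑ c' ∈ Finset.range (n + 2),
      q ^ c' * (if c < c' then T * (if b then 1 else Y) * φ c' True else φ c' False) with hψ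
    have hstep : ∀ σ : Equiv.Perm (Fin (n + 1)),
        ∑ a : Fin (n + 2), q ^ inv (appendLetter a σ) * Y ^ lpk (appendLetter a σ) *
          T ^ des (appendLetter a σ) * φ (n + 1 - (appendLetter a σ) (Fin.last (n + 1)))
            (EndsInDescent (appendLetter a σ)) =
        q ^ inv σ * Y ^ lpk σ * T ^ des σ * ψ (n - σ (Fin.last n)) (EndsInDescent σ) := by
      intro σ
      -- Reversal reindexes the appended letter by the number of letters exceeding it, the variable
      -- c' of ψ.
      rw [hψ, Finset.mul_sum, Finset.sum_range, ← Equiv.sum_comp Fin.revPerm]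
      refine Finset.sum_congr rfl fun a _ => ?_
      have hs := (σ (Fin.last n)).is_lt
      have hc : n + 1 - (Fin.rev a : ℕ) = a := by rw [Fin.val_rev]; omega
      have hle : Fin.rev a ≤ (σ (Fin.last n)).castSucc ↔ n - (σ (Fin.last n) : ℕ) < a := by
        rw [Fin.le_def, Fin.val_rev, Fin.val_castSucc]; omega
      simp only [Fin.revPerm_apply, inv_appendLetter, lpk_appendLetter, des_appendLetter,
        endsInDescent_appendLetter, appendLetter_last, hc, hle]
      by_cases h : n - (σ (Fin.last n) : ℕ) < a <;> by_cases h' : EndsInDescent σ <;>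
        simp [h, h', pow_add] <;> ring
    rw [sum_perm_succ, Finset.sum_congr rfl fun σ _ => hstep σ, ih, hψ]
    simp only [Finset.mul_sum, ← Finset.sum_add_distrib]
    rw [Finset.sum_comm]
    refine Finset.sum_congr rfl fun c' hc' => ?_
    have hc' : c' ≤ n + 1 := Finset.mem_range_succ_iff.1 hc'
    simp only [stateWeights, ascStep, descStep]
    rw [← Finset.sum_range_add_sum_Ico _ hc', ← Finset.sum_range_add_sum_Ico _ hc', add_sub_cancel_left,
      add_comm]
    congr 1
    · rw [Finset.mul_sum, Finset.sum_mul]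
      refine Finset.sum_congr rfl fun c hc => ?_
      simp [not_lt.2 (Finset.mem_Ico.1 hc).1]
      ring
    · rw [Finset.mul_sum, Finset.sum_mul]
      refine Finset.sum_congr rfl fun c hc => ?_
      simp [Finset.mem_range.1 hc]
      ring

lemma invLpkDesPoly_succ (n : ℕ) :
    invLpkDesPoly (n + 1) q Y T = ∑ c ∈ Finset.range (n + 1),
      ((stateWeights q Y T n).1 c + (stateWeights q Y T n).2 c) := by
  simpa [invLpkDesPoly] using sum_perm_eq_sum_stateWeights q Y T n fun _ _ => 1

@[simp] lemma invLpkDesPoly_zero : invLpkDesPoly 0 q Y T = 1 := by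
  simp [invLpkDesPoly, inv, lpk, des]

end States

/-! ### The convolution recurrence. -/

section Recurrence

variable {R : Type*} [CommRing R] (q : R)

/-- A convolution recurrence for the scaled polynomials
`r ^ n * P_n`; the hypotheses express `Y` and `T` through `y`, `t` and `r`. -/
lemma pow_mul_invLpkDesPoly_eq (y t r Y T : R) (hr : (1 - t) * r = 1 + y * t)
    (hT : (1 - t) * r * T = y + t) (hY : (1 - t) * r ^ 2 * (Y * T) = t * (1 + y) * (r + y)) (n : ℕ) :
    r ^ n * invLpkDesPoly n q Y T = (1 - t) + t * ∑ i ∈ Finset.range (n + 1),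
      (∑ k ∈ Finset.range (i + 1), r ^ k * invLpkDesPoly k q Y T *
        (y ^ (i - k) * q ^ (i - k).choose 2 * gaussBinom q i (i - k))) *
      gaussBinom q n (n - i) := by
  set p : ℕ → R := fun n => r ^ n * invLpkDesPoly n q Y T with hp
  set z : ℕ → R := fun n => ∑ k ∈ Finset.range (n + 1), p k *
    (y ^ (n - k) * q ^ (n - k).choose 2 * gaussBinom q n (n - k)) with hz
  -- S weights words made of a permutation of k letters (weight p k), one free letter, then only
  -- descents, each with factor y.
  let S : ℕ → ℕ → R := fun n => Nat.rec (fun _ => 0)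
    (fun n f c => p n * q ^ c + y * descStep q f c) n
  have hS0 : ∀ c, S 0 c = 0 := fun _ => rfl
  have hS : ∀ n c, S (n + 1) c = p n * q ^ c + y * descStep q (S n) c := fun _ _ => rfl
  have hzS : ∀ n, z n = p n + y * ∑ b ∈ Finset.range n, S n b := by
    intro n
    rw [sum_descStep_iterate q y p S hS0 hS, hz]
    simp only []
    rw [Finset.sum_range_succ]
    simp [add_comm]
  -- M is the analogue of S with ascents and initial weights w; the extra 1 - t in w 0 becomes the
  -- term (1-t) exp_q.
  let w : ℕ → R := fun n => (if n = 0 then 1 - t else 0) + t * z n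
  let M : ℕ → ℕ → R := fun n => Nat.rec (fun _ => 0)
    (fun n f c => w n * q ^ c + ascStep q n f c) n
  have hM0 : ∀ c, M 0 c = 0 := fun _ => rfl
  have hM : ∀ n c, M (n + 1) c = w n * q ^ c + ascStep q n (M n) c := fun _ _ => rfl
  have hp0 : p 0 = 1 := by simp [hp]
  have hz0 : z 0 = 1 := by simp [hz, hp0]
  let A : ℕ → ℕ → R := fun n => (stateWeights q Y T n).1
  let B : ℕ → ℕ → R := fun n => (stateWeights q Y T n).2
  have hA : ∀ n b, A (n + 1) b = ascStep q (n + 1) (fun c => A n c + B n c) b := fun _ _ => rfl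
  have hB : ∀ n b, B (n + 1) b = descStep q (fun c => Y * T * A n c + T * B n c) b :=
    fun _ _ => rfl
  have hpAB : ∀ n, p (n + 1) = r ^ (n + 1) * ∑ c ∈ Finset.range (n + 1), (A n c + B n c) := by
    intro n
    simp only [hp, invLpkDesPoly_succ]
    rfl
  -- In the induction, `hY` and `hT` are exactly the matching of the coefficients of A and B in the
  -- descent part.
  have hSAB : ∀ n b, t * (1 + y) * S (n + 1) b =
      t * (1 + y) * r ^ n * A n b + (1 - t) * r ^ (n + 1) * B n b := by
    intro n
    induction n with
    | zero =>
      intro b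
      rw [hS, hp0]
      simp [A, B, stateWeights, descStep, hS0]
    | succ n ih =>
      intro b
      have hsum := Finset.sum_congr (rfl : Finset.range b = Finset.range b) fun c _ => ih c
      rw [hS, hpAB, hA, hB]
      simp only [ascStep, descStep]
      simp only [Finset.sum_add_distrib, ← Finset.mul_sum] at hsum ⊢
      linear_combination y * q ^ b * hsum - q ^ b * r ^ n * (∑ c ∈ Finset.range b, A n c) * hY
        - q ^ b * r ^ (n + 1) * (∑ c ∈ Finset.range b, B n c) * hT
  -- Summed over b, the S term contributes t (z (n+1) - p (n+1)) by `hzS`, which supplies the last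
  -- summand of the recurrence.
  have hMAB : ∀ n b, (1 - t) * r ^ (n + 1) * (A n b + B n b) = M (n + 1) b + t * y * S (n + 1) b := by
    intro n
    induction n with
    | zero =>
      intro b
      rw [hM, hS, hp0]
      simp [A, B, w, stateWeights, descStep, ascStep, hS0, hM0, hz0]
      linear_combination q ^ b * hr
    | succ n ih =>
      intro b
      have hsum : ∀ m, _ := fun m =>
        Finset.sum_congr (rfl : Finset.range m = Finset.range m) fun c _ => ih c
      have hs1 := hsum (n + 1)
      have hs2 := hsum b
      have h2 := hSAB (n + 1) b
      have h3 := hA n b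
      have h4 := hS (n + 1) b
      have h5 := hpAB n
      rw [hM]
      simp only [w, hzS, ascStep, descStep] at h3 h4 ⊢
      simp only [Finset.sum_add_distrib, ← Finset.mul_sum] at hs1 hs2 h3 h4 h5 ⊢
      rw [if_neg n.succ_ne_zero]
      linear_combination r ^ (n + 1) * A (n + 1) b * hr - h2 + q ^ b * hs1 - q ^ b * hs2
        + (1 - t) * r ^ (n + 1) * h3 + t * h4
  change p n = (1 - t) + t * ∑ i ∈ Finset.range (n + 1), z i * gaussBinom q n (n - i)
  cases n with
  | zero => simp [hp0, hz0]
  | succ n =>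
    have hsum := Finset.sum_congr (rfl : Finset.range (n + 1) = Finset.range (n + 1))
      fun c _ => hMAB n c
    rw [Finset.sum_add_distrib, sum_ascStep_iterate q w M hM0 hM, ← Finset.mul_sum,
      ← Finset.mul_sum, mul_assoc, ← hpAB] at hsum
    have hw : ∑ i ∈ Finset.range (n + 1), w i * gaussBinom q (n + 1) (n + 1 - i) =
        (1 - t) + t * ∑ i ∈ Finset.range (n + 1), z i * gaussBinom q (n + 1) (n + 1 - i) := by
      simp only [w, add_mul, Finset.sum_add_distrib, Finset.mul_sum, mul_assoc, ite_mul, zero_mul]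
      simp [gaussBinom_self]
    rw [Finset.sum_range_succ, hzS (n + 1), Nat.sub_self, gaussBinom_zero_right]
    linear_combination hsum + hw

end Recurrence

/-! ### Passage to power series. -/

section Series

variable {K : Type*} [Field K] (q : K)

lemma gaussBinom_div_qFactorial (hq : ∀ n, qFactorial q n ≠ 0) {n i : ℕ} (hi : i ≤ n) :
    gaussBinom q n (n - i) / qFactorial q n = 1 / (qFactorial q i * qFactorial q (n - i)) := by
  have h := gaussBinom_mul_qFactorial q (n - i) i
  rw [Nat.sub_add_cancel hi] at h
  rw [div_eq_div_iff (hq n) (mul_ne_zero (hq _) (hq _))]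
  linear_combination h

/-- Products of `q`-exponential generating functions. -/
lemma mk_mul_mk_div_qFactorial (hq : ∀ n, qFactorial q n ≠ 0) (f g : ℕ → K) :
    (PowerSeries.mk fun n => f n / qFactorial q n) * (PowerSeries.mk fun n => g n / qFactorial q n) =
      PowerSeries.mk fun n => (∑ i ∈ Finset.range (n + 1),
        f i * (g (n - i) * gaussBinom q n (n - i))) / qFactorial q n := by
  ext n
  rw [PowerSeries.coeff_mul, Finset.Nat.sum_antidiagonal_eq_sum_range_succ_mk, PowerSeries.coeff_mk,
    Finset.sum_div]
  refine Finset.sum_congr rfl fun i hi => ?_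
  have h := gaussBinom_div_qFactorial q hq (Finset.mem_range_succ_iff.1 hi)
  simp only [PowerSeries.coeff_mk]
  rw [← mul_assoc, mul_div_assoc, h, div_mul_div_comm, mul_one_div]

lemma mk_pow_mul_invLpkDesPoly_mul (hq : ∀ n, qFactorial q n ≠ 0) (y t : K) (ht : 1 - t ≠ 0)
    (hyt : y + t ≠ 0) (hyt' : 1 + y * t ≠ 0) :
    (PowerSeries.mk fun n => ((1 + y * t) / (1 - t)) ^ n * invLpkDesPoly n q
        ((1 + y) ^ 2 * t / ((y + t) * (1 + y * t))) ((y + t) / (1 + y * t)) / qFactorial q n) *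
      (1 - PowerSeries.C t * PowerSeries.rescale y (qExp q) * qexp q) =
    PowerSeries.C (1 - t) * qexp q := by
  have hrec := pow_mul_invLpkDesPoly_eq q y t ((1 + y * t) / (1 - t))
    ((1 + y) ^ 2 * t / ((y + t) * (1 + y * t))) ((y + t) / (1 + y * t))
    (mul_div_cancel₀ _ ht) (by rw [mul_div_cancel₀ _ ht, mul_div_cancel₀ _ hyt']) (by
      have h : 1 + t * y ≠ 0 := by rwa [mul_comm t y]
      field_simp
      ring)
  have hE : PowerSeries.rescale y (qExp q) =
      PowerSeries.mk fun n => y ^ n * q ^ n.choose 2 / qFactorial q n := by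
    ext n
    simp [qExp, PowerSeries.coeff_rescale, mul_div_assoc]
  set p : ℕ → K := fun n => ((1 + y * t) / (1 - t)) ^ n * invLpkDesPoly n q
        ((1 + y) ^ 2 * t / ((y + t) * (1 + y * t))) ((y + t) / (1 + y * t)) with hp
  have hmul : (PowerSeries.mk fun n => p n / qFactorial q n) *
      PowerSeries.rescale y (qExp q) * qexp q = PowerSeries.mk fun n => (∑ i ∈ Finset.range (n + 1),
        (∑ k ∈ Finset.range (i + 1),
          p k * (y ^ (i - k) * q ^ (i - k).choose 2 * gaussBinom q i (i - k))) *
        (1 * gaussBinom q n (n - i))) / qFactorial q n := by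
    rw [hE, mk_mul_mk_div_qFactorial q hq, qexp, mk_mul_mk_div_qFactorial q hq]
  have hfin : (PowerSeries.mk fun n => p n / qFactorial q n) = PowerSeries.C (1 - t) * qexp q +
      PowerSeries.C t * ((PowerSeries.mk fun n => p n / qFactorial q n) *
        PowerSeries.rescale y (qExp q) * qexp q) := by
    rw [hmul]
    ext n
    simp only [PowerSeries.coeff_mk, map_add, PowerSeries.coeff_C_mul, qexp, one_mul]
    rw [hp]
    simp only []
    rw [hrec n, add_div, mul_div_assoc, mul_one_div]
  linear_combination hfin

end Series

end LeftPeak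

/-! ### The two identities. -/

/-- Here `PowerSeries.rescale c f` is `f(c x)`; both power series that are inverted have nonzero
constant term (`1 - t`, resp. `1 - v`). The element `s` is a square root of `(1 + t)^2 - 4 y t`. -/
theorem theorem4p7 {K : Type*} [Field K] [CharZero K] (q : K)
    (hq : ∀ n : ℕ, LeftPeak.qFactorial q n ≠ 0) :
    (∀ y t : K, 1 - t ≠ 0 → y + t ≠ 0 → 1 + y * t ≠ 0 →
      PowerSeries.C (1 - t) * LeftPeak.qexp q *
          (1 - PowerSeries.C t * PowerSeries.rescale y (LeftPeak.qExp q) * LeftPeak.qexp q)⁻¹ =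
        PowerSeries.mk fun n =>
          ((1 + y * t) / (1 - t)) ^ n *
            LeftPeak.invLpkDesPoly n q
              ((1 + y) ^ 2 * t / ((y + t) * (1 + y * t))) ((y + t) / (1 + y * t)) /
            LeftPeak.qFactorial q n) ∧
    (∀ y t s u v : K, y ≠ 0 → t ≠ 0 → 1 - y ≠ 0 →
      s ^ 2 = (1 + t) ^ 2 - 4 * y * t → s ≠ 0 →
      u = (1 + t ^ 2 - 2 * y * t - (1 - t) * s) / (2 * (1 - y) * t) →
      v = ((1 + t) ^ 2 - 2 * y * t - (1 + t) * s) / (2 * y * t) →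
      1 - v ≠ 0 ∧ 1 + u * v ≠ 0 ∧
      (PowerSeries.mk fun n => LeftPeak.invLpkDesPoly n q y t / LeftPeak.qFactorial q n) =
        PowerSeries.C (1 - v) *
            PowerSeries.rescale ((1 - v) / (1 + u * v)) (LeftPeak.qexp q) *
          (1 - PowerSeries.C v *
              PowerSeries.rescale (u * (1 - v) / (1 + u * v)) (LeftPeak.qExp q) *
              PowerSeries.rescale ((1 - v) / (1 + u * v)) (LeftPeak.qexp q))⁻¹) := by
  have main : ∀ y t : K, 1 - t ≠ 0 → y + t ≠ 0 → 1 + y * t ≠ 0 → _ := fun y t =>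
    LeftPeak.mk_pow_mul_invLpkDesPoly_mul q hq y t
  have hE0 : PowerSeries.constantCoeff (LeftPeak.qExp q) = 1 := by simp [LeftPeak.qExp]
  have he0 : PowerSeries.constantCoeff (LeftPeak.qexp q) = 1 := by simp [LeftPeak.qexp]
  have hresc : ∀ (a : K) (f : PowerSeries K),
      PowerSeries.constantCoeff (PowerSeries.rescale a f) = PowerSeries.constantCoeff f := by
    intro a f
    rw [← PowerSeries.coeff_zero_eq_constantCoeff_apply,
      ← PowerSeries.coeff_zero_eq_constantCoeff_apply, PowerSeries.coeff_rescale]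
    simp
  refine ⟨fun y t ht hyt hyt' => ?_, fun y t s u v hy ht hy1 hs hs0 hu hv => ?_⟩
  · rw [eq_comm, PowerSeries.eq_mul_inv_iff_mul_eq (by simpa [hresc, hE0, he0] using ht)]
    exact main y t ht hyt hyt'
  · have hprod : (1 + t - s) * (1 + t + s) = 4 * y * t := by linear_combination -hs
    -- These factorisations rationalise u and v and show that no denominator below vanishes.
    have hprod' : (s - 1 + t) * (s + 1 - t) = 4 * (1 - y) * t := by linear_combination hs
    have h4 : (4 : K) ≠ 0 := by norm_num
    have h2 : (2 : K) ≠ 0 := by norm_num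
    have ha := mul_ne_zero_iff.1 (hprod ▸ mul_ne_zero (mul_ne_zero h4 hy) ht)
    have hb := mul_ne_zero_iff.1 (hprod' ▸ mul_ne_zero (mul_ne_zero h4 hy1) ht)
    have hv' : v = (1 + t - s) / (1 + t + s) := by
      rw [hv, div_eq_div_iff (mul_ne_zero (mul_ne_zero h2 hy) ht) ha.2]
      linear_combination (1 + t - s) / 2 * hprod - (1 + t + s) / 2 * hs
    have hu' : u = (s - 1 + t) / (s + 1 - t) := by
      rw [hu, div_eq_div_iff (mul_ne_zero (mul_ne_zero h2 hy1) ht) hb.2]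
      linear_combination (s - 1 + t) / 2 * hprod' - (s + 1 - t) / 2 * hs
    have ha2 := ha.2
    have hb2 := hb.2
    have h1v : 1 - v = 2 * s / (1 + t + s) := by rw [hv']; field_simp; ring
    have huv : 1 + u * v = 4 * s / ((s + 1 - t) * (1 + t + s)) := by
      rw [hv', hu']; field_simp; ring
    have huv' : u + v = t * (1 + u * v) := by rw [huv, hu', hv']; field_simp; ring
    have hu1 : (1 + u) ^ 2 * v = y * (t * (1 + u * v) ^ 2) := by
      have : y = (1 + t - s) * (1 + t + s) / (4 * t) := by rw [hprod]; field_simp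
      rw [huv, this, hu', hv']; field_simp; ring
    have n1 : 1 - v ≠ 0 := by rw [h1v]; exact div_ne_zero (mul_ne_zero h2 hs0) ha2
    have n2 : 1 + u * v ≠ 0 := by
      rw [huv]; exact div_ne_zero (mul_ne_zero h4 hs0) (mul_ne_zero hb2 ha2)
    have n3 : u + v ≠ 0 := by rw [huv']; exact mul_ne_zero ht n2
    refine ⟨n1, n2, ?_⟩
    have hT : (u + v) / (1 + u * v) = t := by rw [huv']; field_simp
    have hY : (1 + u) ^ 2 * v / ((u + v) * (1 + u * v)) = y := by
      rw [hu1, huv']; field_simp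
    -- The rescaling of x cancels the factor ((1+uv)/(1-v))^n from (a).
    have h := congrArg (PowerSeries.rescale ((1 - v) / (1 + u * v))) (main u v n1 n3 n2)
    have hL : PowerSeries.rescale ((1 - v) / (1 + u * v)) (PowerSeries.mk fun n =>
        ((1 + u * v) / (1 - v)) ^ n * LeftPeak.invLpkDesPoly n q y t / LeftPeak.qFactorial q n) =
        PowerSeries.mk fun n => LeftPeak.invLpkDesPoly n q y t / LeftPeak.qFactorial q n := by
      ext n
      rw [PowerSeries.coeff_rescale, PowerSeries.coeff_mk, PowerSeries.coeff_mk, mul_div_assoc,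
        ← mul_assoc, ← mul_pow, div_mul_div_cancel₀ n2, div_self n1, one_pow, one_mul]
    have hC : ∀ a b : K, PowerSeries.rescale a (PowerSeries.C b) = PowerSeries.C b := by
      intro a b
      ext n
      rw [PowerSeries.coeff_rescale, PowerSeries.coeff_C]
      split_ifs with h
      · simp [h]
      · simp
    rw [hT, hY, map_mul, hL, map_sub, map_one, map_mul, map_mul, map_mul, hC, hC,
      PowerSeries.rescale_rescale, mul_div_assoc'] at h
    rw [PowerSeries.eq_mul_inv_iff_mul_eq (by simpa [hresc, hE0, he0] using n1)]
    exact h
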